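/- Let $\varphi_0,\varphi_1,\dots$ be an acceptable numbering of the partial recursive functions, $W_e$ the domain of $\varphi_e$, and let $\eta$ be an r.e. (positive) equivalence relation on $\mathbb N$ with infinitely many equivalence classes. A set is $\eta$-infinite if it is a union of infinitely many $\eta$-classes. An $\eta$-family is a class $\mathcal C=\{B_0,B_1,\dots\}$ of unions of $\eta$-classes, where $(B_k)_{k\in\mathbb N}$ is uniformly r.e. and the $B_k$ are pairwise distinct. A text $T$ is a map $\mathbb N\to\mathbb N\cup\{\#\}$; $T[n]$ is its initial segment of length $n$, $\mathrm{cnt}(\cdot)$ denotes the set of numbers occurring in a text or finite sequence, and $T$ is a text for $L$ if $\mathrm{cnt}(T)=L$. A learner is a recursive function $M:(\mathbb N\cup\{\#\})^*\to\mathbb N\cup\{?\}$; a value $e\in\mathbb N$ is a hypothesis and stands for the set $H_e$ of a hypothesis space $(H_e)_{e\in\mathbb N}$, by default $H_e=$ the $\eta$-closure of $W_e$ (the union of the $\eta$-classes of its elements). Then - $M$ Ex-learns $\mathcal C$ if for every $L\in\mathcal C$ and every text $T$ for $L$ there are $n$ and $e$ with $H_e=L$ and $M(T[j])=e$ for all $j\ge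 n$; - $M$ BC-learns $\mathcal C$ if for every $L\in\mathcal C$ and every text $T$ for $L$ there is $n$ such that for all $j\ge n$, $M(T[j])$ is a hypothesis $e$ with $H_e=L$; - $M$ is monotonic on $\mathcal C$ if for every text $T$ for a member of $\mathcal C$ and all $n,k$ such that $M(T[n])=i$ and $M(T[n+k])=j$ are hypotheses, $H_i\cap\mathrm{cnt}(T)\subseteq H_j\cap\mathrm{cnt}(T)$; - $M$ is weakly monotonic if for every text $T$ whatsoever and all $n,k$ such that $M(T[n])=i$ and $M(T[n+k])=j$ are hypotheses, $\mathrm{cnt}(T[n+k])\subseteq H_i$ implies $H_i\subseteq H_j$. $\mathcal C$ is Ex-learnable if some learner Ex-learns it, and monotonically BC-learnable if some learner BC-learns it and is monotonic on it, both with the default hypothesis space. $\mathcal C$ is class-preservingly weakly monotonically Ex-learnable if there are a uniformly r.e. hypothesis space $(H_e)_{e\in\mathbb N}$ with $\{H_e:e\in\mathbb N\}=\mathcal C$ and a weakly monotonic learner that Ex-learns $\mathcal C$, both with respect to $(H_e)_{e\in\mathbb N}$. **Theorem.** The following are equivalent: 1. there is an $\eta$-family that is Ex-learnable but not monotonically BC-learnable;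 2. there is an $\eta$-family that is class-preservingly weakly monotonically Ex-learnable but not monotonically BC-learnable; 3. there is an $\eta$-infinite r.e. set different from $\mathbb N$. -/

import Mathlib

namespace EtaLearning

/-- An acceptable (Goedel) numbering of the unary partial recursive functions: `φ` is a partial
recursive function of two arguments, every unary partial recursive function is some `φ e`, and every
partial recursive numbering `ψ` reduces to `φ` by a recursive function. -/
structure IsAcceptable (φ : ℕ → ℕ →. ℕ) : Prop where
  partrec : Partrec₂ φ
  surj : ∀ f : ℕ →. ℕ, Partrec f → ∃ e, φ e = f
  reduces : ∀ ψ : ℕ → ℕ →. ℕ, Partrec₂ ψ → ∃ c : ℕ → ℕ, Computable c ∧ ∀ e, ψ e = φ (c e)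

/-- The r.e. set `W e`, the domain of `φ e`. -/
def W (φ : ℕ → ℕ →. ℕ) (e : ℕ) : Set ℕ := {x | (φ e x).Dom}

/-- A positive equivalence relation: a recursively enumerable one. -/
def IsPositive (η : Setoid ℕ) : Prop := REPred fun p : ℕ × ℕ => η p.1 p.2

/-- A union of `η`-classes. -/
def IsEtaClosed (η : Setoid ℕ) (A : Set ℕ) : Prop := ∀ x y : ℕ, η x y → x ∈ A → y ∈ A

/-- The `η`-closure of `A`, i.e. the union of the `η`-classes of the elements of `A`. -/
def etaClosure (η : Setoid ℕ) (A : Set ℕ) : Set ℕ := {y | ∃ x ∈ A, η x y}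

/-- A union of infinitely many `η`-classes. -/
def IsEtaInfinite (η : Setoid ℕ) (A : Set ℕ) : Prop :=
  IsEtaClosed η A ∧ ((Quotient.mk η) '' A).Infinite

/-- A uniformly r.e. sequence of sets. -/
def UniformlyRE (B : ℕ → Set ℕ) : Prop := REPred fun p : ℕ × ℕ => p.2 ∈ B p.1

/-- An `η`-family: an (infinite) class with a uniformly r.e. one-one numbering, each of whose
members is a union of `η`-classes. -/
def IsEtaFamily (η : Setoid ℕ) (C : Set (Set ℕ)) : Prop :=
  (∃ B : ℕ → Set ℕ, UniformlyRE B ∧ Function.Injective B ∧ Set.range B = C) ∧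
    ∀ L ∈ C, IsEtaClosed η L

/-- A text; `none` is the pause symbol. -/
abbrev Text := ℕ → Option ℕ

/-- The set of numbers that occur in a text. -/
def Text.content (T : Text) : Set ℕ := {x | ∃ i, T i = some x}

/-- The initial segment `T 0, ..., T (n - 1)`. -/
def Text.init (T : Text) (n : ℕ) : List (Option ℕ) := (List.range n).map T

/-- The set of numbers that occur in a finite sequence. -/
def seqContent (σ : List (Option ℕ)) : Set ℕ := {x | some x ∈ σ}

/-- `M` maps finite sequences of numbers and pauses to hypotheses; the value `none` is the symbol
`?` by which a learner abstains. Learners are moreover required to be `Computable`. -/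
abbrev Learner := List (Option ℕ) → Option ℕ

/-- `M` explanatorily learns `C` with hypothesis space `H`. -/
def ExLearns (H : ℕ → Set ℕ) (M : Learner) (C : Set (Set ℕ)) : Prop :=
  ∀ L ∈ C, ∀ T : Text, T.content = L →
    ∃ n e, H e = L ∧ ∀ j, n ≤ j → M (T.init j) = some e

/-- `M` behaviourally correctly learns `C` with hypothesis space `H`. -/
def BCLearns (H : ℕ → Set ℕ) (M : Learner) (C : Set (Set ℕ)) : Prop :=
  ∀ L ∈ C, ∀ T : Text, T.content = L →
    ∃ n, ∀ j, n ≤ j → ∃ e, M (T.init j) = some e ∧ H e = L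

/-- Monotonicity of `M` with respect to the target class `C` and hypothesis space `H`. -/
def IsMonotonic (H : ℕ → Set ℕ) (M : Learner) (C : Set (Set ℕ)) : Prop :=
  ∀ T : Text, T.content ∈ C → ∀ n k i j : ℕ,
    M (T.init n) = some i → M (T.init (n + k)) = some j →
      H i ∩ T.content ⊆ H j ∩ T.content

/-- Weak monotonicity of `M` with respect to the hypothesis space `H`, on all texts. -/
def IsWeaklyMonotonic (H : ℕ → Set ℕ) (M : Learner) : Prop :=
  ∀ (T : Text) (n k i j : ℕ),
    M (T.init n) = some i → M (T.init (n + k)) = some j →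
      seqContent (T.init (n + k)) ⊆ H i → H i ⊆ H j

/-- The default hypothesis space: the `η`-closures of the sets `W e`. -/
def defaultSpace (φ : ℕ → ℕ →. ℕ) (η : Setoid ℕ) (e : ℕ) : Set ℕ := etaClosure η (W φ e)

/-- Explanatory learnability (default hypothesis space). -/
def ExLearnable (φ : ℕ → ℕ →. ℕ) (η : Setoid ℕ) (C : Set (Set ℕ)) : Prop :=
  ∃ M : Learner, Computable M ∧ ExLearns (defaultSpace φ η) M C

/-- Monotonic behaviourally correct learnability (default hypothesis space). -/
def MonotonicBCLearnable (φ : ℕ → ℕ →. ℕ) (η : Setoid ℕ) (C : Set (Set ℕ)) : Prop :=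
  ∃ M : Learner, Computable M ∧ BCLearns (defaultSpace φ η) M C ∧
    IsMonotonic (defaultSpace φ η) M C

/-- Class-preserving weakly monotonic explanatory learnability: the hypothesis space is some
uniformly r.e. numbering whose members are exactly those of the target class. -/
def ClassPreservingWeaklyMonotonicExLearnable (C : Set (Set ℕ)) : Prop :=
  ∃ H : ℕ → Set ℕ, UniformlyRE H ∧ Set.range H = C ∧
    ∃ M : Learner, Computable M ∧ ExLearns H M C ∧ IsWeaklyMonotonic H M

end EtaLearning

/-!
Let `A` be an r.e. `η`-infinite set with `b ∉ A`, enumerate `A` as `a 0, a 1, …`, and let `S j` be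
the `η`-closure of `{b, a 0, …, a (j - 1)}`. A learner of the class of `A` and all `S j` at some
point conjectures `A` on data contained in some `S n`; the data can then be continued until it
conjectures `S n`, which loses elements of `A`, and afterwards to a text for a larger `S m`
containing one of the lost elements, so the learner is not monotonic. On the other hand, it is safe
to conjecture `A` until `b` appears and then `S j` for the largest `j` such that
`a 0, …, a (j - 1)` have appeared.

Conversely, suppose that every member of a learnable class other than `ℕ` consists of finitely many
`η`-classes. By Angluin's theorem `ℕ`, if it is in the class, has a finite telltale set `D`, which
no other member contains. Conjecturing the data seen so far, and `ℕ` once `D` has appeared, is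
therefore correct in the limit, and these conjectures only grow.
-/

open Filter

namespace EtaLearning

/-! ### Recursively enumerable predicates -/

section RecursivelyEnumerable

variable {α β : Type*} [Primcodable α] [Primcodable β]

/-- `R` is a primitive recursive enumeration in stages of the predicate `p`: `R a s` says that `a`
has been enumerated by stage `s`. -/
structure IsStagedEnumeration (p : α → Prop) (R : α → ℕ → Prop) : Prop where
  primrecRel : PrimrecRel R
  mono : ∀ a s t, s ≤ t → R a s → R a t
  iff_exists : ∀ a, p a ↔ ∃ s, R a s

theorem IsStagedEnumeration.eventually {p : α → Prop} {R : α → ℕ → Prop}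
    (h : IsStagedEnumeration p R) {a : α} (ha : p a) : ∀ᶠ s in atTop, R a s := by
  obtain ⟨s, hs⟩ := (h.iff_exists a).1 ha
  exact eventually_atTop.2 ⟨s, fun t ht => h.mono a s t ht hs⟩

theorem exists_isStagedEnumeration {p : α → Prop} (h : REPred p) :
    ∃ R, IsStagedEnumeration p R := by
  obtain ⟨c, hc⟩ := Nat.Partrec.Code.exists_code.1 h
  refine ⟨fun a s => (Nat.Partrec.Code.evaln s c (Encodable.encode a)).isSome = true,
    ?_, fun a s t hst hs => ?_, fun a => ?_⟩
  · have hp : Primrec₂ fun (a : α) (s : ℕ) =>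
        (Nat.Partrec.Code.evaln s c (Encodable.encode a)).isSome :=
      Primrec.option_isSome.comp (Nat.Partrec.Code.primrec_evaln.comp
        ((Primrec.snd.pair (Primrec.const c)).pair (Primrec.encode.comp Primrec.fst)))
    exact Primrec₂.primrecRel (hp.of_eq fun a s => by simp)
  · obtain ⟨x, hx⟩ := Option.isSome_iff_exists.1 hs
    exact Option.isSome_iff_exists.2 ⟨x, Nat.Partrec.Code.evaln_mono hst hx⟩
  · have hdom : p a ↔ (Nat.Partrec.Code.eval c (Encodable.encode a)).Dom := by
      simp [hc, Part.assert]
    simp only [hdom, Part.dom_iff_mem, Option.isSome_iff_exists, Nat.Partrec.Code.evaln_complete]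
    exact exists_comm

theorem rePred_of_primrecPred {p : α → Prop} (h : PrimrecPred p) : REPred p :=
  h.computablePred.to_re

theorem rePred_const (p : Prop) : REPred fun _ : α => p :=
  rePred_of_primrecPred ⟨fun _ => Classical.dec p, Primrec.const _⟩

theorem rePred_exists_of_primrecRel {R : α → ℕ → Prop} (h : PrimrecRel R) :
    REPred fun a => ∃ s, R a s := by
  classical
  have hp : Partrec fun a => Nat.rfind fun s => Part.some (decide (R a s)) :=
    Partrec.rfind (Computable.partrec h.decide.to_comp)
  exact (Partrec.dom_re hp).of_eq fun a => Nat.rfind_dom.trans (by simp)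

theorem rePred_comp {p : β → Prop} (hp : REPred p) {f : α → β} (hf : Computable f) :
    REPred fun a => p (f a) :=
  Partrec.comp hp hf

theorem rePred_mem_comp {γ : Type*} [Primcodable γ] {G : β → Set γ}
    (hG : REPred fun x : β × γ => x.2 ∈ G x.1) {f : α → β} {g : α → γ} (hf : Computable f)
    (hg : Computable g) : REPred fun a => g a ∈ G (f a) :=
  rePred_comp hG (hf.pair hg)

theorem rePred_and {p q : α → Prop} (hp : REPred p) (hq : REPred q) :
    REPred fun a => p a ∧ q a := by
  obtain ⟨R, hR⟩ := exists_isStagedEnumeration hp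
  obtain ⟨S, hS⟩ := exists_isStagedEnumeration hq
  have h : PrimrecRel fun a s => R a s ∧ S a s := PrimrecPred.and hR.primrecRel hS.primrecRel
  refine (rePred_exists_of_primrecRel h).of_eq fun a => ⟨?_, fun ⟨hp, hq⟩ => ?_⟩
  · exact fun ⟨s, hRs, hSs⟩ => ⟨(hR.iff_exists a).2 ⟨s, hRs⟩, (hS.iff_exists a).2 ⟨s, hSs⟩⟩
  · exact ((hR.eventually hp).and (hS.eventually hq)).exists

theorem rePred_or {p q : α → Prop} (hp : REPred p) (hq : REPred q) :
    REPred fun a => p a ∨ q a := by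
  obtain ⟨R, hR⟩ := exists_isStagedEnumeration hp
  obtain ⟨S, hS⟩ := exists_isStagedEnumeration hq
  have h : PrimrecRel fun a s => R a s ∨ S a s := PrimrecPred.or hR.primrecRel hS.primrecRel
  exact (rePred_exists_of_primrecRel h).of_eq fun a => by
    rw [hR.iff_exists, hS.iff_exists, exists_or]

theorem rePred_exists {p : α → β → Prop} (hp : REPred fun x : α × β => p x.1 x.2) :
    REPred fun a => ∃ b, p a b := by
  obtain ⟨R, hR⟩ := exists_isStagedEnumeration hp
  have h : PrimrecRel fun (a : α) (n : ℕ) =>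
      ∃ b ∈ (Encodable.decode (α := β) n.unpair.1).toList, R (a, b) n.unpair.2 := by
    have hR' : PrimrecRel fun (b : β) (x : α × ℕ) => R (x.1, b) x.2 :=
      hR.primrecRel.comp ((Primrec.fst.comp Primrec.snd).pair Primrec.fst)
        (Primrec.snd.comp Primrec.snd)
    have hn : Primrec fun x : α × ℕ => x.2.unpair := Primrec.unpair.comp Primrec.snd
    exact hR'.exists_mem_list.comp
      (Primrec.optionToList.comp (Primrec.decode.comp (Primrec.fst.comp hn)))
      (Primrec.fst.pair (Primrec.snd.comp hn))
  refine (rePred_exists_of_primrecRel h).of_eq fun a => ⟨?_, fun ⟨b, hb⟩ => ?_⟩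
  · exact fun ⟨_, b, _, hb⟩ => ⟨b, (hR.iff_exists (a, b)).2 ⟨_, hb⟩⟩
  · obtain ⟨s, hs⟩ := (hR.iff_exists (a, b)).1 hb
    exact ⟨Nat.pair (Encodable.encode b) s, b, by simpa using hs⟩

theorem rePred_forall_mem_list {p : α → β → Prop} (hp : REPred fun x : α × β => p x.1 x.2) :
    REPred fun x : α × List β => ∀ b ∈ x.2, p x.1 b := by
  obtain ⟨R, hR⟩ := exists_isStagedEnumeration hp
  have h : PrimrecRel fun (x : α × List β) (s : ℕ) => ∀ b ∈ x.2, R (x.1, b) s := by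
    have hR' : PrimrecRel fun (b : β) (y : α × ℕ) => R (y.1, b) y.2 :=
      hR.primrecRel.comp ((Primrec.fst.comp Primrec.snd).pair Primrec.fst)
        (Primrec.snd.comp Primrec.snd)
    exact hR'.forall_mem_list.comp (Primrec.snd.comp Primrec.fst)
      ((Primrec.fst.comp Primrec.fst).pair Primrec.snd)
  refine (rePred_exists_of_primrecRel h).of_eq fun x => ⟨?_, fun hx => ?_⟩
  · exact fun ⟨s, hs⟩ b hb => (hR.iff_exists (x.1, b)).2 ⟨s, hs b hb⟩
  · have hev : ∀ᶠ s in atTop, ∀ b ∈ x.2, R (x.1, b) s :=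
      (eventually_all_finite (List.finite_toSet x.2)).2 fun b hb => hR.eventually (hx b hb)
    exact hev.exists

theorem primrecRel_mem_list : PrimrecRel fun (l : List α) (a : α) => a ∈ l :=
  Primrec.eq.exists_mem_list.of_eq fun l a => by simp

theorem rePred_mem_range {f : α → β} (hf : Computable f) :
    REPred fun b => b ∈ Set.range f :=
  rePred_exists (p := fun b a => f a = b)
    (rePred_comp (f := fun x : β × α => (f x.2, x.1)) (rePred_of_primrecPred Primrec.eq)
      ((hf.comp Computable.snd).pair Computable.fst))

theorem exists_primrec_range_eq {A : Set ℕ} (hA : REPred fun x => x ∈ A) (hne : A.Nonempty) :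
    ∃ a : ℕ → ℕ, Primrec a ∧ Set.range a = A := by
  classical
  obtain ⟨R, hR⟩ := exists_isStagedEnumeration hA
  obtain ⟨x₀, hx₀⟩ := hne
  have hfst : Primrec fun n : ℕ => n.unpair.1 := Primrec.fst.comp Primrec.unpair
  refine ⟨fun n => if R n.unpair.1 n.unpair.2 then n.unpair.1 else x₀,
    Primrec.ite (hR.primrecRel.comp hfst (Primrec.snd.comp Primrec.unpair)) hfst (Primrec.const x₀),
    Set.Subset.antisymm ?_ fun x hx => ?_⟩
  · rintro _ ⟨n, rfl⟩
    dsimp only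
    split_ifs with h
    · exact (hR.iff_exists _).2 ⟨_, h⟩
    · exact hx₀
  · obtain ⟨s, hs⟩ := (hR.iff_exists x).1 hx
    exact ⟨Nat.pair x s, by simp [hs]⟩

theorem rePred_count_le {p : ℕ → Prop} [DecidablePred p] (hp : REPred fun i => ¬ p i) :
    REPred fun x : ℕ × ℕ => Nat.count p x.1 ≤ x.2 := by
  have hmem : REPred fun y : List ℕ × ℕ => y.2 ∈ y.1 ∨ ¬ p y.2 :=
    rePred_or (rePred_of_primrecPred primrecRel_mem_list) (rePred_comp hp Computable.snd)
  have hall : REPred fun y : (ℕ × ℕ) × List ℕ => ∀ i ∈ List.range y.1.1, i ∈ y.2 ∨ ¬ p i :=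
    rePred_comp (f := fun y : (ℕ × ℕ) × List ℕ => (y.2, List.range y.1.1))
      (rePred_forall_mem_list (p := fun (l : List ℕ) i => i ∈ l ∨ ¬ p i) hmem)
      (Primrec.snd.pair (Primrec.list_range.comp (Primrec.fst.comp Primrec.fst))).to_comp
  have hlen : REPred fun y : (ℕ × ℕ) × List ℕ => y.2.length ≤ y.1.2 :=
    rePred_of_primrecPred (Primrec.nat_le.comp (Primrec.list_length.comp Primrec.snd)
      (Primrec.snd.comp Primrec.fst))
  refine (rePred_exists (p := fun (x : ℕ × ℕ) (l : List ℕ) =>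
    l.length ≤ x.2 ∧ ∀ i ∈ List.range x.1, i ∈ l ∨ ¬ p i) (rePred_and hlen hall)).of_eq fun x => ?_
  simp only [List.mem_range, Nat.count_eq_card_filter_range]
  constructor
  · rintro ⟨l, hl, h⟩
    have hsub : {i ∈ Finset.range x.1 | p i} ⊆ l.toFinset := fun i hi => by
      rw [Finset.mem_filter, Finset.mem_range] at hi
      exact List.mem_toFinset.2 ((h i hi.1).resolve_right (not_not.2 hi.2))
    exact (Finset.card_le_card hsub).trans (l.toFinset_card_le.trans hl)
  · intro h
    refine ⟨{i ∈ Finset.range x.1 | p i}.toList, by simpa using h, fun i hi => ?_⟩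
    simpa [hi] using em (p i)

end RecursivelyEnumerable

/-! ### Texts and locking sequences -/

section Texts

theorem seqContent_mono {σ τ : List (Option ℕ)} (h : σ <+: τ) : seqContent σ ⊆ seqContent τ :=
  fun _ hx => h.subset hx

theorem seqContent_append_singleton (σ : List (Option ℕ)) (o : Option ℕ) :
    seqContent (σ ++ [o]) = seqContent σ ∪ {x | o = some x} := by
  ext x
  simp [seqContent, eq_comm]

theorem finite_seqContent (σ : List (Option ℕ)) : (seqContent σ).Finite :=
  σ.finite_toSet.preimage (Option.some_injective ℕ).injOn

theorem Text.length_init (T : Text) (n : ℕ) : (T.init n).length = n := by simp [Text.init]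

theorem Text.init_isPrefix_init (T : Text) {m n : ℕ} (h : m ≤ n) : T.init m <+: T.init n := by
  rw [List.prefix_iff_eq_take, T.length_init, Text.init, Text.init, ← List.map_take,
    List.take_range, min_eq_left h]

theorem Text.init_length_eq_of_isPrefix {T : Text} {σ τ : List (Option ℕ)} (h : σ <+: τ)
    (hτ : T.init τ.length = τ) : T.init σ.length = σ := by
  have hpre : T.init σ.length <+: τ := hτ ▸ T.init_isPrefix_init h.length_le
  exact (List.prefix_of_prefix_length_le hpre h (T.length_init _).le).eq_of_length
    (T.length_init _)

theorem Text.seqContent_init_subset (T : Text) (n : ℕ) : seqContent (T.init n) ⊆ T.content := by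
  intro x hx
  obtain ⟨i, -, hi⟩ := List.mem_map.1 hx
  exact ⟨i, hi⟩

theorem Text.eventually_mem_seqContent_init (T : Text) {x : ℕ} (hx : x ∈ T.content) :
    ∀ᶠ n in atTop, x ∈ seqContent (T.init n) := by
  obtain ⟨i, hi⟩ := hx
  exact (eventually_gt_atTop i).mono fun n hn => List.mem_map.2 ⟨i, List.mem_range.2 hn, hi⟩

theorem Text.eventually_subset_seqContent_init (T : Text) {D : Set ℕ} (hD : D.Finite)
    (h : D ⊆ T.content) : ∀ᶠ n in atTop, D ⊆ seqContent (T.init n) :=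
  (eventually_all_finite hD).2 fun _ hx => T.eventually_mem_seqContent_init (h hx)

theorem Text.content_eq_iUnion_seqContent (T : Text) {l : ℕ → ℕ} (hl : ∀ n, n ≤ l n) :
    T.content = ⋃ n, seqContent (T.init (l n)) := by
  refine Set.Subset.antisymm (fun x hx => ?_)
    (Set.iUnion_subset fun n => T.seqContent_init_subset (l n))
  obtain ⟨n, hn⟩ := (T.eventually_mem_seqContent_init hx).exists
  exact Set.mem_iUnion.2 ⟨n, seqContent_mono (T.init_isPrefix_init (hl n)) hn⟩

theorem exists_text_of_seqContent_subset {σ : List (Option ℕ)} {L : Set ℕ}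
    (h : seqContent σ ⊆ L) : ∃ T : Text, T.content = L ∧ T.init σ.length = σ := by
  classical
  let T : Text := fun i =>
    if hi : i < σ.length then σ[i] else if i - σ.length ∈ L then some (i - σ.length) else none
  refine ⟨T, Set.Subset.antisymm ?_ fun x hx => ⟨σ.length + x, by simp [T, hx]⟩, ?_⟩
  · rintro x ⟨i, hi⟩
    dsimp only [T] at hi
    split_ifs at hi with hlt hL
    · exact h (List.mem_of_getElem hi)
    · exact Option.some.inj hi ▸ hL
  · exact List.ext_getElem (T.length_init _) fun i _ hi => by simp [Text.init, T, hi]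

theorem exists_text_of_prefix_chain {g : ℕ → List (Option ℕ)} (hg : ∀ n, g n <+: g (n + 1))
    (hlen : ∀ n, n ≤ (g n).length) : ∃ T : Text, ∀ n, T.init (g n).length = g n := by
  have hmono : ∀ {m n}, m ≤ n → g m <+: g n := fun {m n} h => by
    induction n, h using Nat.le_induction with
    | base => exact List.prefix_refl _
    | succ n _ ih => exact ih.trans (hg n)
  refine ⟨fun i => (g (i + 1))[i]'(hlen (i + 1)), fun n => ?_⟩
  refine List.ext_getElem (Text.length_init _ _) fun i _ hi => ?_
  simp only [Text.init, List.getElem_map, List.getElem_range]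
  rcases le_total (i + 1) n with h | h
  · exact (hmono h).getElem _
  · exact ((hmono h).getElem hi).symm

theorem exists_text_frequently {L : Set ℕ} {Q : List (Option ℕ) → Prop}
    (hQ : ∀ σ, seqContent σ ⊆ L → ∃ τ, σ <+: τ ∧ seqContent τ ⊆ L ∧ Q τ) :
    ∃ T : Text, T.content = L ∧ ∃ᶠ n in atTop, Q (T.init n) := by
  obtain ⟨T₀, hT₀, -⟩ := exists_text_of_seqContent_subset (σ := []) (L := L) (by simp [seqContent])
  have hstep : ∀ (σ : {σ // seqContent σ ⊆ L}) (n : ℕ), ∃ τ : {τ // seqContent τ ⊆ L},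
      σ.1 ++ [T₀ n] <+: τ.1 ∧ Q τ.1 := fun ⟨σ, hσ⟩ n => by
    obtain ⟨τ, hpre, hτ, hQτ⟩ := hQ (σ ++ [T₀ n]) <| by
      rw [seqContent_append_singleton]
      exact Set.union_subset hσ fun x hx => hT₀ ▸ ⟨n, hx⟩
    exact ⟨⟨τ, hτ⟩, hpre, hQτ⟩
  choose step hpre hstepQ using hstep
  let g : ℕ → {σ // seqContent σ ⊆ L} := fun n =>
    Nat.rec ⟨[], by simp [seqContent]⟩ (fun n σ => step σ n) n
  have hg : ∀ n, (g n).1 ++ [T₀ n] <+: (g (n + 1)).1 := fun n => hpre (g n) n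
  have hlen : ∀ n, n ≤ (g n).1.length := fun n => by
    induction n with
    | zero => exact Nat.zero_le _
    | succ n ih => exact (Nat.succ_le_succ ih).trans (by simpa using (hg n).length_le)
  obtain ⟨T, hT⟩ :=
    exists_text_of_prefix_chain (fun n => (List.prefix_append _ _).trans (hg n)) hlen
  refine ⟨T, ?_, frequently_atTop.2 fun n => ⟨(g (n + 1)).1.length,
    (Nat.le_succ n).trans (hlen _), (hT (n + 1)).symm ▸ hstepQ (g n) n⟩⟩
  simp only [T.content_eq_iUnion_seqContent hlen, hT]
  refine Set.Subset.antisymm (Set.iUnion_subset fun n => (g n).2) fun x hx => ?_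
  obtain ⟨i, hi⟩ : x ∈ T₀.content := hT₀.symm ▸ hx
  exact Set.mem_iUnion.2 ⟨i + 1, (hg i).subset (by simp [hi])⟩

end Texts

section Learners

variable {H : ℕ → Set ℕ} {M : Learner} {C : Set (Set ℕ)} {L : Set ℕ}

theorem ExLearns.bcLearns (h : ExLearns H M C) : BCLearns H M C := fun L hL T hT => by
  obtain ⟨n, e, he, hn⟩ := h L hL T hT
  exact ⟨n, fun j hj => ⟨e, hn j hj, he⟩⟩

theorem BCLearns.exists_isPrefix (h : BCLearns H M C) (hL : L ∈ C) {σ : List (Option ℕ)}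
    (hσ : seqContent σ ⊆ L) :
    ∃ τ, σ <+: τ ∧ seqContent τ ⊆ L ∧ ∃ e, M τ = some e ∧ H e = L := by
  obtain ⟨T, hT, hTσ⟩ := exists_text_of_seqContent_subset hσ
  obtain ⟨n, hn⟩ := h L hL T hT
  refine ⟨T.init (max n σ.length), ?_, hT ▸ T.seqContent_init_subset _, hn _ (le_max_left _ _)⟩
  exact (hTσ ▸ T.init_isPrefix_init (le_max_right _ _) :)

/-- A locking sequence for `L`: within `L`, the learner `M` sticks to hypotheses for `L` on all
extensions of `σ`. -/
def IsLockingSequence (H : ℕ → Set ℕ) (M : Learner) (L : Set ℕ) (σ : List (Option ℕ)) : Prop :=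
  seqContent σ ⊆ L ∧ ∀ τ, σ <+: τ → seqContent τ ⊆ L → ∃ e, M τ = some e ∧ H e = L

theorem BCLearns.exists_isLockingSequence (h : BCLearns H M C) (hL : L ∈ C) :
    ∃ σ, IsLockingSequence H M L σ := by
  by_contra! hcon
  obtain ⟨T, hT, hfreq⟩ := exists_text_frequently (L := L)
    (Q := fun τ => ¬ ∃ e, M τ = some e ∧ H e = L) fun σ hσ => by
      have hσ' := hcon σ
      simp only [IsLockingSequence, not_and, not_forall] at hσ'
      obtain ⟨τ, hpre, hτ, hbad⟩ := hσ' hσ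
      exact ⟨τ, hpre, hτ, by simpa using hbad⟩
  exact hfreq (eventually_atTop.2 ((h L hL T hT).imp fun n hn j hj => not_not.2 (hn j hj)))

theorem BCLearns.exists_telltale (h : BCLearns H M C) (hL : L ∈ C) :
    ∃ D ⊆ L, D.Finite ∧ ∀ L' ∈ C, D ⊆ L' → L' ⊆ L → L' = L := by
  obtain ⟨σ, hσ, hlock⟩ := h.exists_isLockingSequence hL
  refine ⟨seqContent σ, hσ, finite_seqContent σ, fun L' hL' hσL' hsub => ?_⟩
  obtain ⟨τ, hpre, hτ, e, he, heL'⟩ := h.exists_isPrefix hL' hσL'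
  obtain ⟨e', he', heL⟩ := hlock τ hpre (hτ.trans hsub)
  rw [← heL', ← heL, Option.some.inj (he.symm.trans he')]

theorem IsMonotonic.inter_subset_of_isPrefix (h : IsMonotonic H M C) (hL : L ∈ C)
    {σ τ : List (Option ℕ)} (hpre : σ <+: τ) (hτ : seqContent τ ⊆ L) {i j : ℕ}
    (hi : M σ = some i) (hj : M τ = some j) : H i ∩ L ⊆ H j := by
  obtain ⟨T, rfl, hTτ⟩ := exists_text_of_seqContent_subset hτ
  refine (h T hL σ.length (τ.length - σ.length) i j ?_ ?_).trans Set.inter_subset_left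
  · rwa [Text.init_length_eq_of_isPrefix hpre hTτ]
  · rwa [Nat.add_sub_cancel' hpre.length_le, hTτ]

theorem BCLearns.not_isMonotonic_of_chain (h : BCLearns H M C) {A : Set ℕ} (hA : A ∈ C)
    {S : ℕ → Set ℕ} (hS : ∀ n, S n ∈ C) (hmono : Monotone S) (hcover : A ⊆ ⋃ n, S n)
    (hproper : ∀ n, ¬ A ⊆ S n) : ¬ IsMonotonic H M C := by
  intro hM
  obtain ⟨σ, -, hσ, e, he, heA⟩ := h.exists_isPrefix hA (σ := []) (by simp [seqContent])
  obtain ⟨n, hn⟩ : ∃ n, seqContent σ ⊆ S n := by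
    rw [← (finite_seqContent σ).coe_toFinset]
    refine hmono.directed_le.exists_mem_subset_of_finset_subset_biUnion ?_
    simpa using hσ.trans hcover
  obtain ⟨τ, hpre, hτ, e', he', heS⟩ := h.exists_isPrefix (hS n) hn
  obtain ⟨x, hxA, hxn⟩ := Set.not_subset.1 (hproper n)
  obtain ⟨m, hm⟩ := Set.mem_iUnion.1 (hcover hxA)
  have hsub : H e ∩ S (max m n) ⊆ H e' :=
    hM.inter_subset_of_isPrefix (hS _) hpre (hτ.trans (hmono (le_max_right m n))) he he'
  rw [heA, heS] at hsub
  exact hxn (hsub ⟨hxA, hmono (le_max_left m n) hm⟩)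

end Learners

/-! ### Closures and hypothesis spaces -/

section EtaClosure

variable {η : Setoid ℕ}

theorem subset_etaClosure (η : Setoid ℕ) (A : Set ℕ) : A ⊆ etaClosure η A :=
  fun x hx => ⟨x, hx, η.refl x⟩

theorem IsEtaClosed.etaClosure_subset {A L : Set ℕ} (hL : IsEtaClosed η L) (h : A ⊆ L) :
    etaClosure η A ⊆ L :=
  fun y ⟨x, hx, hxy⟩ => hL x y hxy (h hx)

theorem IsEtaClosed.etaClosure_eq {L : Set ℕ} (hL : IsEtaClosed η L) : etaClosure η L = L :=
  (hL.etaClosure_subset subset_rfl).antisymm (subset_etaClosure η L)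

theorem etaClosure_mono {A B : Set ℕ} (h : A ⊆ B) : etaClosure η A ⊆ etaClosure η B :=
  fun _ ⟨x, hx, hxy⟩ => ⟨x, h hx, hxy⟩

theorem isEtaClosed_etaClosure (η : Setoid ℕ) (A : Set ℕ) : IsEtaClosed η (etaClosure η A) :=
  fun _ _ hxy ⟨z, hz, hzx⟩ => ⟨z, hz, η.trans hzx hxy⟩

theorem image_mk_etaClosure (η : Setoid ℕ) (A : Set ℕ) :
    Quotient.mk η '' etaClosure η A = Quotient.mk η '' A := by
  refine Set.Subset.antisymm ?_ (Set.image_mono (subset_etaClosure η A))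
  rintro _ ⟨y, ⟨x, hx, hxy⟩, rfl⟩
  exact ⟨x, hx, Quotient.sound hxy⟩

end EtaClosure

section HypothesisSpaces

variable {φ : ℕ → ℕ →. ℕ} {η : Setoid ℕ} {C : Set (Set ℕ)}

theorem IsAcceptable.exists_reduction {α : Type*} [Primcodable α] (hφ : IsAcceptable φ)
    {G : α → Set ℕ} (hG : REPred fun p : α × ℕ => p.2 ∈ G p.1) :
    ∃ c : α → ℕ, Computable c ∧ ∀ a, W φ (c a) = G a := by
  have hdecode : REPred fun p : ℕ × ℕ => ∃ a : α, Encodable.encode a = p.1 ∧ p.2 ∈ G a :=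
    rePred_exists (p := fun (p : ℕ × ℕ) (a : α) => Encodable.encode a = p.1 ∧ p.2 ∈ G a) <|
      rePred_and
        (rePred_of_primrecPred (Primrec.eq.comp (Primrec.encode.comp Primrec.snd)
          (Primrec.fst.comp Primrec.fst)))
        (rePred_mem_comp hG Computable.snd (Computable.snd.comp Computable.fst))
  obtain ⟨c, hc, h⟩ := hφ.reduces
    (fun e x => (Part.assert (∃ a : α, Encodable.encode a = e ∧ x ∈ G a)
      fun _ => Part.some ()).map fun _ => 0)
    (Partrec.map (σ := ℕ) hdecode (Computable.const 0).to₂)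
  refine ⟨fun a => c (Encodable.encode a), hc.comp Computable.encode, fun a => ?_⟩
  ext x
  simp [W, ← h, Part.assert]

theorem ExLearns.exLearnable (hφ : IsAcceptable φ) (hC : ∀ L ∈ C, IsEtaClosed η L)
    {H : ℕ → Set ℕ} (hH : UniformlyRE H) {M : Learner} (hM : Computable M)
    (h : ExLearns H M C) : ExLearnable φ η C := by
  obtain ⟨c, hc, hcH⟩ := hφ.exists_reduction hH
  refine ⟨fun σ => (M σ).map c, Computable.option_map hM (hc.comp Computable.snd).to₂,
    fun L hL T hT => ?_⟩
  obtain ⟨n, e, he, hn⟩ := h L hL T hT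
  refine ⟨n, c e, ?_, fun j hj => congrArg (Option.map c) (hn j hj)⟩
  rw [defaultSpace, hcH, he, (hC L hL).etaClosure_eq]

theorem monotonicBCLearnable_of_increasing_conjectures (hφ : IsAcceptable φ)
    {G : List (Option ℕ) → Set ℕ} (hG : REPred fun p : List (Option ℕ) × ℕ => p.2 ∈ G p.1)
    (hmono : ∀ σ τ, σ <+: τ → G σ ⊆ G τ)
    (hlim : ∀ T : Text, T.content ∈ C → ∀ᶠ j in atTop, etaClosure η (G (T.init j)) = T.content) :
    MonotonicBCLearnable φ η C := by
  obtain ⟨c, hc, hcG⟩ := hφ.exists_reduction hG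
  refine ⟨fun σ => some (c σ), Computable.option_some.comp hc, ?_, ?_⟩
  · rintro _ hL T rfl
    refine eventually_atTop.1 ((hlim T hL).mono fun j hj => ⟨_, rfl, ?_⟩)
    rw [defaultSpace, hcG, hj]
  · rintro T - n k _ _ ⟨⟩ ⟨⟩
    refine Set.inter_subset_inter_left _ ?_
    simp only [defaultSpace, hcG]
    exact etaClosure_mono (hmono _ _ (T.init_isPrefix_init (n.le_add_right k)))

end HypothesisSpaces

section Guess

variable {φ : ℕ → ℕ →. ℕ} {η : Setoid ℕ} {C : Set (Set ℕ)} {D : Set ℕ}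

/-- The conjecture made from the data `σ` if all members of `C` other than `ℕ` consist of finitely
many classes and `D` is a telltale set of `ℕ`: once `D` has appeared guess `ℕ`, provided it belongs
to `C`, and until then what has been seen. -/
def guess (C : Set (Set ℕ)) (D : Set ℕ) (σ : List (Option ℕ)) : Set ℕ :=
  {x | (Set.univ ∈ C ∧ D ⊆ seqContent σ) ∨ x ∈ seqContent σ}

theorem guess_mono {σ τ : List (Option ℕ)} (h : σ <+: τ) : guess C D σ ⊆ guess C D τ :=
  fun _ => Or.imp (And.imp_right fun hD => hD.trans (seqContent_mono h)) fun hx =>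
    seqContent_mono h hx

theorem rePred_mem_guess (hD : D.Finite) :
    REPred fun p : List (Option ℕ) × ℕ => p.2 ∈ guess C D p.1 := by
  have hmem : REPred fun p : List (Option ℕ) × ℕ => p.2 ∈ seqContent p.1 :=
    rePred_of_primrecPred
      (primrecRel_mem_list.comp Primrec.fst (Primrec.option_some.comp Primrec.snd))
  have hsub : REPred fun p : List (Option ℕ) × ℕ => D ⊆ seqContent p.1 :=
    (rePred_comp (rePred_forall_mem_list (p := fun σ x => x ∈ seqContent σ) hmem)
      (Computable.fst.pair (Computable.const hD.toFinset.toList))).of_eq fun p => by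
        simp [Set.subset_def]
  exact rePred_or (rePred_and (rePred_const _) hsub) hmem

theorem eventually_subset_etaClosure_seqContent (T : Text)
    (hfin : (Quotient.mk η '' T.content).Finite) :
    ∀ᶠ j in atTop, T.content ⊆ etaClosure η (seqContent (T.init j)) := by
  obtain ⟨F, hF, hFfin, himg⟩ :=
    Set.exists_subset_image_finite_and.1 ⟨_, subset_rfl, hfin, subset_rfl⟩
  filter_upwards [T.eventually_subset_seqContent_init hFfin hF] with j hj x hx
  obtain ⟨y, hy, hyx⟩ := himg (Set.mem_image_of_mem _ hx)
  exact ⟨y, hj hy, Quotient.exact hyx⟩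

theorem eventually_etaClosure_guess_eq (hC : ∀ L ∈ C, IsEtaClosed η L)
    (hfin : ∀ L ∈ C, L ≠ Set.univ → (Quotient.mk η '' L).Finite)
    (hD : Set.univ ∈ C → ∀ L ∈ C, D ⊆ L → L = Set.univ) (hDfin : D.Finite)
    (T : Text) (hT : T.content ∈ C) :
    ∀ᶠ j in atTop, etaClosure η (guess C D (T.init j)) = T.content := by
  by_cases huniv : T.content = Set.univ
  · rw [huniv] at hT ⊢
    filter_upwards [T.eventually_subset_seqContent_init hDfin (huniv ▸ D.subset_univ)] with j hj
    exact Set.univ_subset_iff.1 (Set.Subset.trans (fun x _ => Or.inl ⟨hT, hj⟩)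
      (subset_etaClosure η _))
  · filter_upwards [eventually_subset_etaClosure_seqContent T (hfin _ hT huniv)] with j hj
    refine Set.Subset.antisymm ((hC _ hT).etaClosure_subset ?_)
      (hj.trans (etaClosure_mono fun x => Or.inr))
    rintro x (⟨hmem, hsub⟩ | hx)
    · exact absurd (hD hmem _ hT (hsub.trans (T.seqContent_init_subset j))) huniv
    · exact T.seqContent_init_subset j hx

theorem exists_etaInfinite_of_not_monotonicBCLearnable (hφ : IsAcceptable φ)
    (hC : ∀ L ∈ C, IsEtaClosed η L) {H : ℕ → Set ℕ} {M : Learner} (h : BCLearns H M C)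
    (hnot : ¬ MonotonicBCLearnable φ η C) : ∃ A ∈ C, IsEtaInfinite η A ∧ A ≠ Set.univ := by
  by_contra! hcon
  obtain ⟨D, hDfin, hD⟩ :
      ∃ D : Set ℕ, D.Finite ∧ (Set.univ ∈ C → ∀ L ∈ C, D ⊆ L → L = Set.univ) := by
    by_cases huniv : Set.univ ∈ C
    · obtain ⟨D, -, hDfin, hD⟩ := h.exists_telltale huniv
      exact ⟨D, hDfin, fun _ L hL hDL => hD L hL hDL L.subset_univ⟩
    · exact ⟨∅, Set.finite_empty, fun hmem => absurd hmem huniv⟩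
  have hfin : ∀ L ∈ C, L ≠ Set.univ → (Quotient.mk η '' L).Finite := fun L hL hne =>
    Set.not_infinite.1 fun hinf => hne (hcon L hL ⟨hC L hL, hinf⟩)
  exact hnot (monotonicBCLearnable_of_increasing_conjectures hφ (rePred_mem_guess hDfin)
    (fun _ _ => guess_mono) (eventually_etaClosure_guess_eq hC hfin hD hDfin))

end Guess

section Numberings

variable {S : ℕ → Set ℕ}

theorem IsEtaFamily.rePred_mem {η : Setoid ℕ} {C : Set (Set ℕ)} (hC : IsEtaFamily η C) {L : Set ℕ}
    (hL : L ∈ C) : REPred fun x => x ∈ L := by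
  obtain ⟨⟨B, hB, -, rfl⟩, -⟩ := hC
  obtain ⟨n, rfl⟩ := hL
  exact rePred_mem_comp hB (Computable.const n) Computable.id

/-- The sequence `A, S 0, S 1, …`, used to adjoin one set to a numbered class. -/
def prependSet (A : Set ℕ) (S : ℕ → Set ℕ) : ℕ → Set ℕ
  | 0 => A
  | n + 1 => S n

theorem range_prependSet (A : Set ℕ) (S : ℕ → Set ℕ) :
    Set.range (prependSet A S) = insert A (Set.range S) := by
  ext L
  rw [Set.mem_range, ← Nat.or_exists_add_one, Set.mem_insert_iff, eq_comm (a := L)]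
  rfl

theorem prependSet_injective {A : Set ℕ} (hS : Function.Injective S) (hA : A ∉ Set.range S) :
    Function.Injective (prependSet A S)
  | 0, 0, _ => rfl
  | 0, n + 1, h => absurd ⟨n, h.symm⟩ hA
  | m + 1, 0, h => absurd ⟨m, h⟩ hA
  | _ + 1, _ + 1, h => congrArg (· + 1) (hS h)

theorem uniformlyRE_prependSet {A : Set ℕ} (hA : REPred fun x => x ∈ A) (hS : UniformlyRE S) :
    UniformlyRE (prependSet A S) := by
  have hzero : PrimrecPred fun p : ℕ × ℕ => p.1 = 0 := Primrec.eq.comp Primrec.fst (Primrec.const 0)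
  have hpred : Computable fun p : ℕ × ℕ => p.1.pred :=
    (Primrec.pred.comp Primrec.fst).to_comp
  have hfst : REPred fun p : ℕ × ℕ => p.1 = 0 ∧ p.2 ∈ A :=
    rePred_and (rePred_of_primrecPred hzero) (rePred_comp hA Computable.snd)
  have hrest : REPred fun p : ℕ × ℕ => ¬ p.1 = 0 ∧ p.2 ∈ S p.1.pred :=
    rePred_and (rePred_of_primrecPred hzero.not) (rePred_mem_comp hS hpred Computable.snd)
  refine (rePred_or hfst hrest).of_eq ?_
  rintro ⟨_ | n, x⟩ <;> simp [prependSet]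

theorem eq_of_count_succ_ne_eq {α : Type*} {S : ℕ → α}
    [DecidablePred fun i => S (i + 1) ≠ S i] {j k : ℕ} (hjk : j ≤ k)
    (h : Nat.count (fun i => S (i + 1) ≠ S i) k = Nat.count (fun i => S (i + 1) ≠ S i) j) :
    S k = S j := by
  induction k, hjk using Nat.le_induction with
  | base => rfl
  | succ k hjk ih =>
    have hle := Nat.count_monotone (fun i => S (i + 1) ≠ S i) hjk
    rw [Nat.count_succ] at h
    split_ifs at h with hk
    · omega
    · exact (not_not.1 hk).trans (ih h)

theorem infinite_succ_ne_of_unbounded {α : Type*} [Preorder α] {S : ℕ → α} (hmono : Monotone S)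
    (hunb : ∀ n, ∃ m, ¬ S m ≤ S n) : {i | S (i + 1) ≠ S i}.Infinite := by
  refine Nat.frequently_atTop_iff_infinite.1 (frequently_atTop.2 fun n => ?_)
  by_contra! hcon
  obtain ⟨m, hm⟩ := hunb n
  have hconst : ∀ k, n ≤ k → S k = S n :=
    Nat.le_induction rfl fun k hk ih => (hcon k hk).trans ih
  exact hm ((hmono (le_max_right n m)).trans (hconst _ (le_max_left n m)).le)

theorem exists_injective_numbering_of_monotone (hS : UniformlyRE S) (hmono : Monotone S)
    (hstep : REPred fun i => S (i + 1) = S i) (hunb : ∀ n, ∃ m, ¬ S m ⊆ S n) :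
    ∃ B : ℕ → Set ℕ, UniformlyRE B ∧ Function.Injective B ∧ Set.range B = Set.range S := by
  classical
  -- `B n` is the set just before the `n`-th proper step of the sequence `S`.
  let p : ℕ → Prop := fun i => S (i + 1) ≠ S i
  have hp : {i | p i}.Infinite := infinite_succ_ne_of_unbounded hmono hunb
  refine ⟨fun n => S (Nat.nth p n), ?_, ?_, Set.Subset.antisymm ?_ ?_⟩
  · have hcount : REPred fun i : ℕ × ℕ => Nat.count p i.1 ≤ i.2 :=
      rePred_count_le (hstep.of_eq fun i => not_not.symm)
    refine (rePred_exists (p := fun (x : ℕ × ℕ) j => Nat.count p j ≤ x.1 ∧ x.2 ∈ S j)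
      (rePred_and
        (rePred_comp hcount (f := fun x : (ℕ × ℕ) × ℕ => (x.2, x.1.1))
          (Computable.snd.pair (Computable.fst.comp Computable.fst)))
        (rePred_mem_comp hS Computable.snd (Computable.snd.comp Computable.fst)))).of_eq ?_
    rintro ⟨n, x⟩
    simp only [Nat.count_le_iff_le_nth hp]
    exact ⟨fun ⟨_, hj, hx⟩ => hmono hj hx, fun hx => ⟨_, le_rfl, hx⟩⟩
  · have hB : StrictMono fun n => S (Nat.nth p n) := fun m n hmn =>
      (lt_of_le_of_ne (hmono (Nat.le_succ _)) (Nat.nth_mem_of_infinite hp m).symm).trans_le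
        (hmono (Nat.nth_strictMono hp hmn))
    exact hB.injective
  · exact Set.range_comp_subset_range _ S
  · rintro _ ⟨j, rfl⟩
    exact ⟨Nat.count p j,
      eq_of_count_succ_ne_eq (Nat.le_nth_count hp j) (Nat.count_nth_of_infinite hp _)⟩

end Numberings

/-! ### Marked initial segments -/

section MarkedClass

variable {η : Setoid ℕ} {a : ℕ → ℕ} {b : ℕ}

/-- The `j`-th initial segment of the sequence `a`, marked with the point `b` and closed under
`η`. -/
def markedInitial (η : Setoid ℕ) (a : ℕ → ℕ) (b j : ℕ) : Set ℕ :=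
  etaClosure η (insert b (a '' Set.Iio j))

/-- The class separating Ex-learning from monotonic BC-learning: the range of `a` together with the
marked initial segments of `a`. -/
def markedClass (η : Setoid ℕ) (a : ℕ → ℕ) (b : ℕ) : Set (Set ℕ) :=
  insert (Set.range a) (Set.range (markedInitial η a b))

theorem mark_mem_markedInitial (j : ℕ) : b ∈ markedInitial η a b j :=
  subset_etaClosure η _ (Set.mem_insert _ _)

theorem mem_markedInitial {i j : ℕ} (h : i < j) : a i ∈ markedInitial η a b j :=
  subset_etaClosure η _ (Or.inr ⟨i, h, rfl⟩)

theorem IsEtaClosed.markedInitial_subset {L : Set ℕ} (hL : IsEtaClosed η L) (hb : b ∈ L) {j : ℕ}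
    (ha : ∀ i < j, a i ∈ L) : markedInitial η a b j ⊆ L :=
  hL.etaClosure_subset (Set.insert_subset hb (Set.image_subset_iff.2 ha))

theorem monotone_markedInitial : Monotone (markedInitial η a b) := fun _ _ hij =>
  etaClosure_mono (Set.insert_subset_insert (Set.image_mono (Set.Iio_subset_Iio hij)))

theorem markedInitial_succ_eq_iff {i : ℕ} :
    markedInitial η a b (i + 1) = markedInitial η a b i ↔ a i ∈ markedInitial η a b i := by
  refine ⟨fun h => h ▸ mem_markedInitial i.lt_succ_self, fun h => Set.Subset.antisymm ?_
    (monotone_markedInitial i.le_succ)⟩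
  refine (isEtaClosed_etaClosure η _).markedInitial_subset (mark_mem_markedInitial i) fun k hk => ?_
  rcases Nat.lt_succ_iff_lt_or_eq.1 hk with hk | rfl
  · exact mem_markedInitial hk
  · exact h

theorem exists_notMem_markedInitial (h : (Quotient.mk η '' Set.range a).Infinite) (n : ℕ) :
    ∃ m, a m ∉ markedInitial η a b n := by
  by_contra! hcon
  refine h (Set.Finite.subset ?_ (Set.image_mono (Set.range_subset_iff.2 hcon)))
  rw [markedInitial, image_mk_etaClosure]
  exact (((Set.finite_Iio n).image a).insert b).image _

theorem exists_first_notMem_markedInitial (h : (Quotient.mk η '' Set.range a).Infinite) (n : ℕ) :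
    ∃ m, (∀ i < m, a i ∈ markedInitial η a b n) ∧ a m ∉ markedInitial η a b n ∧
      markedInitial η a b m = markedInitial η a b n := by
  classical
  have hex := exists_notMem_markedInitial (b := b) h n
  have hlt : ∀ i < Nat.find hex, a i ∈ markedInitial η a b n :=
    fun i hi => not_not.1 (Nat.find_min hex hi)
  refine ⟨Nat.find hex, hlt, Nat.find_spec hex, Set.Subset.antisymm ?_ ?_⟩
  · exact (isEtaClosed_etaClosure η _).markedInitial_subset (mark_mem_markedInitial n) hlt
  · exact monotone_markedInitial (not_lt.1 fun hn => Nat.find_spec hex (mem_markedInitial hn))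

theorem uniformlyRE_markedInitial (hη : IsPositive η) (ha : Computable a) :
    UniformlyRE (markedInitial η a b) := by
  have hmem : REPred fun p : (ℕ × ℕ) × ℕ => η (a p.2) p.1.2 ∧ p.2 < p.1.1 :=
    rePred_and
      (rePred_comp hη ((ha.comp Computable.snd).pair (Computable.snd.comp Computable.fst)))
      (rePred_of_primrecPred (Primrec.nat_lt.comp Primrec.snd (Primrec.fst.comp Primrec.fst)))
  have hmark : REPred fun p : ℕ × ℕ => η b p.2 :=
    rePred_comp hη ((Computable.const b).pair Computable.snd)
  refine (rePred_or hmark (rePred_exists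
    (p := fun (p : ℕ × ℕ) i => η (a i) p.2 ∧ i < p.1) hmem)).of_eq fun p => ?_
  simp only [markedInitial, etaClosure, Set.mem_ofPred_eq, Set.exists_mem_insert,
    Set.exists_mem_image, Set.mem_Iio, and_comm]

theorem isEtaFamily_markedClass (hη : IsPositive η) (ha : Computable a)
    (hA : IsEtaInfinite η (Set.range a)) (hb : b ∉ Set.range a) :
    IsEtaFamily η (markedClass η a b) := by
  have hS : UniformlyRE (markedInitial η a b) := uniformlyRE_markedInitial hη ha
  have hstep : REPred fun i => markedInitial η a b (i + 1) = markedInitial η a b i := by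
    simp only [markedInitial_succ_eq_iff]
    exact rePred_mem_comp hS Computable.id ha
  have hunb : ∀ n, ∃ m, ¬ markedInitial η a b m ⊆ markedInitial η a b n := fun n => by
    obtain ⟨m, hm⟩ := exists_notMem_markedInitial hA.2 n
    exact ⟨m + 1, fun h => hm (h (mem_markedInitial m.lt_succ_self))⟩
  obtain ⟨B, hB, hBinj, hBrange⟩ :=
    exists_injective_numbering_of_monotone hS monotone_markedInitial hstep hunb
  refine ⟨⟨prependSet (Set.range a) B, uniformlyRE_prependSet (rePred_mem_range ha) hB,
    prependSet_injective hBinj ?_, by rw [range_prependSet, hBrange, markedClass]⟩, ?_⟩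
  · rw [hBrange]
    rintro ⟨j, hj⟩
    exact hb (hj ▸ mark_mem_markedInitial j)
  · rintro _ (rfl | ⟨j, rfl⟩)
    · exact hA.1
    · exact isEtaClosed_etaClosure η _

theorem not_isMonotonic_of_bcLearns_markedClass
    (hA : (Quotient.mk η '' Set.range a).Infinite) {H : ℕ → Set ℕ} {M : Learner}
    (h : BCLearns H M (markedClass η a b)) : ¬ IsMonotonic H M (markedClass η a b) := by
  refine h.not_isMonotonic_of_chain (Set.mem_insert _ _) (fun n => Or.inr ⟨n, rfl⟩)
    monotone_markedInitial ?_ fun n hsub => ?_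
  · rintro _ ⟨i, rfl⟩
    exact Set.mem_iUnion.2 ⟨i + 1, mem_markedInitial i.lt_succ_self⟩
  · obtain ⟨m, hm⟩ := exists_notMem_markedInitial hA n
    exact hm (hsub ⟨m, rfl⟩)

end MarkedClass

section MarkedLearner

variable {η : Setoid ℕ} {a : ℕ → ℕ} {b : ℕ}

open Classical in
/-- The length of the longest initial segment of the sequence `a` that has appeared in `σ`, cut off
at the length of `σ`. -/
noncomputable def seenLength (a : ℕ → ℕ) (σ : List (Option ℕ)) : ℕ :=
  Nat.findGreatest (fun j => ∀ i < j, some (a i) ∈ σ) σ.length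

open Classical in
/-- The learner of the marked class with respect to the numbering `prependSet`: guess the range of
`a` until the mark `b` appears, and the marked initial segment seen so far from then on. -/
noncomputable def markedLearner (a : ℕ → ℕ) (b : ℕ) : Learner := fun σ =>
  if some b ∈ σ then some (seenLength a σ + 1) else some 0

theorem mem_of_lt_seenLength {σ : List (Option ℕ)} {i : ℕ} (h : i < seenLength a σ) :
    some (a i) ∈ σ := by
  classical
  exact Nat.findGreatest_spec (P := fun j => ∀ i < j, some (a i) ∈ σ) (Nat.zero_le _)
    (fun _ hi => absurd hi (Nat.not_lt_zero _)) i h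

theorem seenLength_mono {σ τ : List (Option ℕ)} (h : σ <+: τ) : seenLength a σ ≤ seenLength a τ :=
  Nat.findGreatest_mono (fun _ hj i hi => h.subset (hj i hi)) h.length_le

theorem eventually_seenLength_eq (T : Text) {m : ℕ} (hlt : ∀ i < m, a i ∈ T.content)
    (hm : a m ∉ T.content) : ∀ᶠ n in atTop, seenLength a (T.init n) = m := by
  have hseen : ∀ᶠ n in atTop, ∀ i < m, some (a i) ∈ T.init n :=
    (eventually_all_finite (Set.finite_Iio m)).2 fun i hi =>
      T.eventually_mem_seqContent_init (hlt i hi)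
  filter_upwards [hseen, eventually_ge_atTop m] with n hn hmn
  refine le_antisymm (not_lt.1 fun h => ?_)
    (Nat.le_findGreatest (hmn.trans (T.length_init n).ge) hn)
  exact hm (T.seqContent_init_subset n (mem_of_lt_seenLength h))

theorem computable_markedLearner (ha : Primrec a) (b : ℕ) : Computable (markedLearner a b) := by
  classical
  have hmem : PrimrecRel fun (i : ℕ) (σ : List (Option ℕ)) => some (a i) ∈ σ :=
    primrecRel_mem_list.comp Primrec.snd (Primrec.option_some.comp (ha.comp Primrec.fst))
  have hseen : PrimrecRel fun (σ : List (Option ℕ)) j => ∀ i < j, some (a i) ∈ σ :=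
    PrimrecPred.of_eq
      (hmem.forall_mem_list.comp (Primrec.list_range.comp Primrec.snd) Primrec.fst) (by simp)
  have hlength : Primrec (seenLength a) :=
    (Primrec.nat_findGreatest Primrec.list_length hseen).of_eq fun σ => by
      rw [seenLength]
  have hmark : PrimrecPred fun σ : List (Option ℕ) => some b ∈ σ :=
    primrecRel_mem_list.comp Primrec.id (Primrec.const (some b))
  exact (Primrec.ite hmark (Primrec.option_some.comp (Primrec.succ.comp hlength))
    (Primrec.const (some 0))).to_comp.of_eq fun σ => by simp [markedLearner]

theorem exLearns_markedLearner (hA : (Quotient.mk η '' Set.range a).Infinite)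
    (hb : b ∉ Set.range a) :
    ExLearns (prependSet (Set.range a) (markedInitial η a b)) (markedLearner a b)
      (markedClass η a b) := by
  rintro L (rfl | ⟨k, rfl⟩) T hT
  · refine ⟨0, 0, rfl, fun n _ => if_neg fun hmem => hb ?_⟩
    exact hT ▸ T.seqContent_init_subset n hmem
  · obtain ⟨m, hlt, hm, heq⟩ := exists_first_notMem_markedInitial (b := b) hA k
    have hbT : b ∈ T.content := hT ▸ mark_mem_markedInitial k
    obtain ⟨n, hn⟩ := eventually_atTop.1 ((T.eventually_mem_seqContent_init hbT).and
      (eventually_seenLength_eq T (hT ▸ hlt) (hT ▸ hm)))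
    refine ⟨n, m + 1, heq, fun j hj => ?_⟩
    rw [← (hn j hj).2]
    exact if_pos (hn j hj).1

theorem isWeaklyMonotonic_markedLearner (hb : b ∉ Set.range a) :
    IsWeaklyMonotonic (prependSet (Set.range a) (markedInitial η a b)) (markedLearner a b) := by
  intro T n k i j hi hj hsub
  have hpre := T.init_isPrefix_init (n.le_add_right k)
  by_cases hmem : some b ∈ T.init n
  · obtain rfl := Option.some.inj ((if_pos hmem).symm.trans hi)
    obtain rfl := Option.some.inj ((if_pos (hpre.subset hmem)).symm.trans hj)
    exact monotone_markedInitial (seenLength_mono hpre)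
  · obtain rfl := Option.some.inj ((if_neg hmem).symm.trans hi)
    obtain rfl := Option.some.inj ((if_neg fun h => hb (hsub h)).symm.trans hj)
    exact subset_rfl

theorem classPreservingWeaklyMonotonicExLearnable_markedClass (hη : IsPositive η) (ha : Primrec a)
    (hA : (Quotient.mk η '' Set.range a).Infinite) (hb : b ∉ Set.range a) :
    ClassPreservingWeaklyMonotonicExLearnable (markedClass η a b) :=
  ⟨prependSet (Set.range a) (markedInitial η a b),
    uniformlyRE_prependSet (rePred_mem_range ha.to_comp) (uniformlyRE_markedInitial hη ha.to_comp),
    range_prependSet _ _, markedLearner a b, computable_markedLearner ha b,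
    exLearns_markedLearner hA hb, isWeaklyMonotonic_markedLearner hb⟩

end MarkedLearner

end EtaLearning

theorem theorem7p7 (φ : ℕ → ℕ →. ℕ) (hφ : EtaLearning.IsAcceptable φ)
    (η : Setoid ℕ) (hη : EtaLearning.IsPositive η) (hinf : Infinite (Quotient η)) :
    List.TFAE [
      ∃ C : Set (Set ℕ), EtaLearning.IsEtaFamily η C ∧ EtaLearning.ExLearnable φ η C ∧
        ¬ EtaLearning.MonotonicBCLearnable φ η C,
      ∃ C : Set (Set ℕ), EtaLearning.IsEtaFamily η C ∧
        EtaLearning.ClassPreservingWeaklyMonotonicExLearnable C ∧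
        ¬ EtaLearning.MonotonicBCLearnable φ η C,
      ∃ A : Set ℕ, EtaLearning.IsEtaInfinite η A ∧ (REPred fun x : ℕ => x ∈ A) ∧
        A ≠ Set.univ] := by
  tfae_have 1 → 3 := by
    rintro ⟨C, hC, ⟨M, -, hM⟩, hnot⟩
    obtain ⟨A, hA, hAinf, hne⟩ :=
      EtaLearning.exists_etaInfinite_of_not_monotonicBCLearnable hφ hC.2 hM.bcLearns hnot
    exact ⟨A, hAinf, hC.rePred_mem hA, hne⟩
  tfae_have 2 → 1 := by
    rintro ⟨C, hC, ⟨H, hH, -, M, hM, hEx, -⟩, hnot⟩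
    exact ⟨C, hC, hEx.exLearnable hφ hC.2 hH hM, hnot⟩
  tfae_have 3 → 2 := by
    rintro ⟨A, hA, hre, hne⟩
    obtain ⟨b, hb⟩ := (Set.ne_univ_iff_exists_notMem A).1 hne
    obtain ⟨a, ha, rfl⟩ :=
      EtaLearning.exists_primrec_range_eq hre (Set.image_nonempty.1 hA.2.nonempty)
    exact ⟨EtaLearning.markedClass η a b,
      EtaLearning.isEtaFamily_markedClass hη ha.to_comp hA hb,
      EtaLearning.classPreservingWeaklyMonotonicExLearnable_markedClass hη ha hA.2 hb,
      fun ⟨_, _, hBC, hmon⟩ =>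
        EtaLearning.not_isMonotonic_of_bcLearns_markedClass hA.2 hBC hmon⟩
  tfae_finish
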